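/- **Theorem 5.1.** For positive integers $m \le n$ with $m^2 \equiv m \pmod n$, let $M_{m,n} = \{m, m+n, m+2n, \dots\} \cup \{1\}$ be the corresponding arithmetical congruence monoid (under multiplication). Let $p$ be a prime, let $\alpha \ge 1$, and let $1 \le a \le b$ be integers with $\gcd(a,b)=1$ and $(ap^\alpha)^2 \equiv ap^\alpha \pmod{bp^\alpha}$, so that $M = M_{ap^\alpha,\, bp^\alpha}$ is a local singular arithmetical congruence monoid. Let $\beta$ be the least positive integer such that $p^\beta \in M$. Then the catenary degree of $M$ is $$ c(M) = \begin{cases} 2 & \text{if } \alpha = \beta = 1,\\ 3 & \text{if } \alpha = \beta > 1,\\ 1 + \lceil \beta/\alpha \rceil & \text{if } \alpha < \beta. \end{cases} $$ Here a factorization of $x \in M$ is a finite multiset of atoms (irreducible elements) of $M$ with product $x$. The distance $d(z,w)$ of two factorizations $z,w$ of $x$ is the larger of the numbers of atoms left in $z$ and in $w$ after their common part (with multiplicity) is removed from both. The catenary degree $c(x)$ is the least positive integer $N$ such that any two factorizations $z, w$ of $x$ are joined by a finite sequence $z = z_0, z_1, \dots, z_t = w$ of factorizations of $x$ with $d(z_{i-1},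 z_i) \le N$ for $1 \le i \le t$; and $c(M) = \sup_{x \in M} c(x)$. -/

import Mathlib

namespace ACM

/-- The arithmetical congruence monoid `{a, a + b, a + 2b, …} ∪ {1}`, as a multiplicative
submonoid of `ℕ`; closure under multiplication is the congruence `a² ≡ a (mod b)`. -/
def acm (a b : ℕ) (h : a ^ 2 ≡ a [MOD b]) : Submonoid ℕ where
  carrier := {x | x = 1 ∨ ∃ k : ℕ, x = a + k * b}
  one_mem' := Or.inl rfl
  mul_mem' := by
    rintro x y (rfl | ⟨k, rfl⟩) (rfl | ⟨l, rfl⟩)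
    · exact Or.inl rfl
    · exact Or.inr ⟨l, by ring⟩
    · exact Or.inr ⟨k, by ring⟩
    · right
      have hle : a ≤ a ^ 2 := Nat.le_self_pow two_ne_zero a
      obtain ⟨t, ht⟩ := (Nat.modEq_iff_dvd' hle).mp h.symm
      have ht' : a ^ 2 = a + t * b := by
        rw [mul_comm t b]; omega
      refine ⟨t + a * l + k * a + k * l * b, ?_⟩
      calc (a + k * b) * (a + l * b) = a ^ 2 + (a * l + k * a + k * l * b) * b := by ring
        _ = _ := by rw [ht']; ring

/-- An arithmetical congruence monoid is reduced: `1` is its only unit. -/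
instance acm_reduced (a b : ℕ) (h : a ^ 2 ≡ a [MOD b]) : Subsingleton (acm a b h)ˣ := by
  refine ⟨fun u v => ?_⟩
  have key : ∀ w : (acm a b h)ˣ, w = 1 := by
    intro w
    have hw : ((w : acm a b h) : ℕ) * ((w⁻¹ : (acm a b h)ˣ) : acm a b h) = 1 :=
      congrArg Subtype.val w.mul_inv
    exact Units.ext (Subtype.ext (Nat.eq_one_of_mul_eq_one_right hw))
  rw [key u, key v]

/-- The factorizations of `x` in a reduced commutative monoid `M`: the finite multisets of atoms
of `M` (elements of the free commutative monoid on the atoms) whose product is `x`. -/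
def factorizations {M : Type*} [CommMonoid M] [Subsingleton Mˣ] (x : M) : Set (Multiset M) :=
  {z | (∀ u ∈ z, Irreducible u) ∧ z.prod = x}

/-- The distance of two factorizations: remove the common part (with multiplicity) from both and
take the larger of the two remaining lengths. -/
def factorizationDist {M : Type*} [DecidableEq M] (z w : Multiset M) : ℕ :=
  max (z - w).card (w - z).card

/-- There is an `N`-chain of factorizations of `x` from `z` to `w`: a finite sequence
`c 0 = z, c 1, …, c t = w` of factorizations of `x` whose consecutive distances are at most `N`. -/
def HasChain {M : Type*} [CommMonoid M] [Subsingleton Mˣ] [DecidableEq M]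
    (x : M) (N : ℕ) (z w : Multiset M) : Prop :=
  ∃ (t : ℕ) (c : ℕ → Multiset M), c 0 = z ∧ c t = w ∧
    (∀ i ≤ t, c i ∈ factorizations x) ∧
    ∀ i < t, factorizationDist (c i) (c (i + 1)) ≤ N

/-- The catenary degree of an element: the least positive integer `N` such that any two
factorizations of `x` are joined by an `N`-chain (`⊤` if there is no such `N`). -/
noncomputable def elementCatenaryDegree {M : Type*} [CommMonoid M] [Subsingleton Mˣ]
    [DecidableEq M] (x : M) : ℕ∞ :=
  sInf {c : ℕ∞ | ∃ N : ℕ, c = N ∧ 0 < N ∧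
    ∀ z ∈ factorizations x, ∀ w ∈ factorizations x, HasChain x N z w}

/-- The catenary degree of a monoid: the supremum of the catenary degrees of its elements. -/
noncomputable def catenaryDegree (M : Type*) [CommMonoid M] [Subsingleton Mˣ]
    [DecidableEq M] : ℕ∞ :=
  ⨆ x : M, elementCatenaryDegree x

end ACM

/-!
Write `v` for the `p`-adic valuation. Since `a p ^ α ≡ 1 (mod b)`, the monoid `M` consists of `1`
and the positive integers `x ≡ 1 (mod b)` with `p ^ α ∣ x`. Hence nonunits have `v ≥ α`, the power
`P = p ^ β` is an atom, and `P` divides in `M` every element with `v ≥ α + β`.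

These three facts already give the upper bound (`ValuedAtom.catenaryDegree_le`), by induction on
`v x`. If `v x < α + β`, all factorizations of `x` are short. Otherwise, a minimal part of a
factorization whose product `y` has `v y ≥ α + β` contains few atoms, and can be replaced by `P`
times a factorization of `y / P`; since `v y ≤ 2 (α + β - 1)`, the new part is short as well. Thus
every factorization of `x` is joined to one containing `P`, and `P` can be cancelled.

For the lower bounds, distinct factorizations of an element have distance at least `2`
(`ChainStep.eq`), and at least `3` if their lengths differ (`ChainStep.card_eq`).
Suitable elements are `(p u) ^ 2 = p * (p u ^ 2)` when `α = β = 1` and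
`(p ^ (2 α - 1) u) ^ 2 = p ^ α * p ^ α * (p ^ (2 α - 2) u ^ 2)` when `α = β > 1`. When `α < β`, let
`r = ⌈β / α⌉`, choose a prime `q ≡ a (mod b)` by Dirichlet's theorem, and put `g = p ^ α q`. The
power `g ^ r` factors only as `g * ⋯ * g` (`eq_of_irreducible_of_mul_eq_pow`), so the factorization
`g * ⋯ * g` of `g ^ (r + 1)` shares no atom with any other one; and there is another one, as
`v (g ^ (r + 1)) ≥ α + β` makes `g ^ (r + 1)` divisible by `P`.
-/

namespace ACM

/-! ### Chains of factorizations -/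

section Chains

lemma factorizationDist_add_left {M : Type*} [DecidableEq M] (s z w : Multiset M) :
    factorizationDist (s + z) (s + w) = factorizationDist z w := by
  simp [factorizationDist, add_tsub_add_eq_tsub_left]

lemma factorizationDist_le {M : Type*} [DecidableEq M] {z w : Multiset M} {N : ℕ}
    (hz : z.card ≤ N) (hw : w.card ≤ N) :
    factorizationDist z w ≤ N :=
  max_le ((Multiset.card_le_card tsub_le_self).trans hz)
    ((Multiset.card_le_card tsub_le_self).trans hw)

lemma factorizationDist_comm {M : Type*} [DecidableEq M] (z w : Multiset M) :
    factorizationDist z w = factorizationDist w z := max_comm _ _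

variable {M : Type*} [CommMonoid M] [Subsingleton Mˣ]

lemma add_mem_factorizations {x y : M} {z w : Multiset M} (hz : z ∈ factorizations x)
    (hw : w ∈ factorizations y) : z + w ∈ factorizations (x * y) := by
  refine ⟨fun u hu => ?_, by rw [Multiset.prod_add, hz.2, hw.2]⟩
  rcases Multiset.mem_add.1 hu with h | h
  exacts [hz.1 u h, hw.1 u h]

lemma cons_mem_factorizations {P y : M} {z : Multiset M} (hP : Irreducible P)
    (hz : z ∈ factorizations y) : P ::ₘ z ∈ factorizations (P * y) := by
  refine ⟨fun u hu => ?_, by rw [Multiset.prod_cons, hz.2]⟩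
  rcases Multiset.mem_cons.1 hu with rfl | h
  exacts [hP, hz.1 u h]

variable [DecidableEq M]

/-- The relation of being consecutive in an `N`-chain of factorizations of `x`. -/
def ChainStep (x : M) (N : ℕ) (z w : Multiset M) : Prop :=
  z ∈ factorizations x ∧ w ∈ factorizations x ∧ factorizationDist z w ≤ N

lemma ChainStep.symm {x : M} {N : ℕ} {z w : Multiset M} (h : ChainStep x N z w) :
    ChainStep x N w z :=
  ⟨h.2.1, h.1, factorizationDist_comm z w ▸ h.2.2⟩

lemma ChainStep.cons {P y : M} {N : ℕ} {z w : Multiset M} (hP : Irreducible P)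
    (h : ChainStep y N z w) : ChainStep (P * y) N (P ::ₘ z) (P ::ₘ w) := by
  refine ⟨cons_mem_factorizations hP h.1, cons_mem_factorizations hP h.2.1, ?_⟩
  rw [← Multiset.singleton_add, ← Multiset.singleton_add, factorizationDist_add_left]
  exact h.2.2

lemma hasChain_of_reflTransGen {x : M} {N : ℕ} {z w : Multiset M} (hw : w ∈ factorizations x)
    (h : Relation.ReflTransGen (ChainStep x N) z w) : HasChain x N z w := by
  induction h using Relation.ReflTransGen.head_induction_on with
  | refl => exact ⟨0, fun _ => w, rfl, rfl, fun _ _ => hw, by simp⟩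
  | head h _ ih =>
    rename_i z' u _
    obtain ⟨t, c, h0, ht, hc, hd⟩ := ih
    refine ⟨t + 1, fun i => Nat.casesOn i z' c, rfl, ht, ?_, ?_⟩
    · rintro (_ | i) hi
      · exact h.1
      · exact hc i (by omega)
    · rintro (_ | i) hi
      · change factorizationDist z' (c 0) ≤ N
        rw [h0]
        exact h.2.2
      · exact hd i (by omega)

/-- A property preserved by steps of length at most `N` is preserved by `N`-chains. -/
lemma HasChain.induction {x : M} {N : ℕ} {z w : Multiset M} (h : HasChain x N z w)
    (Q : Multiset M → Prop) (hz : Q z)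
    (hQ : ∀ u v, ChainStep x N u v → Q u → Q v) : Q w := by
  obtain ⟨t, c, rfl, rfl, hc, hd⟩ := h
  have key : ∀ i ≤ t, Q (c i) := by
    intro i
    induction i with
    | zero => exact fun _ => hz
    | succ i ih =>
      exact fun hi => hQ _ _ ⟨hc i (by omega), hc _ hi, hd i (by omega)⟩ (ih (by omega))
  exact key t le_rfl

lemma catenaryDegree_le {N : ℕ} (hN : 0 < N)
    (h : ∀ x : M, ∀ z ∈ factorizations x, ∀ w ∈ factorizations x, HasChain x N z w) :
    catenaryDegree M ≤ N :=
  iSup_le fun x => sInf_le ⟨N, rfl, hN, h x⟩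

/-- If some property of factorizations of `x` is preserved by steps of length at most `N`, and
separates two of them, then the catenary degree exceeds `N`. -/
lemma succ_le_catenaryDegree {x : M} {N : ℕ} {z w : Multiset M} (hz : z ∈ factorizations x)
    (hw : w ∈ factorizations x) (Q : Multiset M → Prop) (hQz : Q z) (hQw : ¬ Q w)
    (hQ : ∀ u v, ChainStep x N u v → Q u → Q v) :
    ((N + 1 : ℕ) : ℕ∞) ≤ catenaryDegree M := by
  refine le_iSup_of_le x (le_sInf ?_)
  rintro _ ⟨K, rfl, -, hK⟩
  by_contra hlt
  have hKN : K ≤ N := by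
    have := Nat.cast_lt.1 (not_le.1 hlt)
    omega
  exact hQw ((hK z hz w hw).induction Q hQz
    fun u v h => hQ u v ⟨h.1, h.2.1, h.2.2.trans hKN⟩)

end Chains

/-! ### The upper bound from a valuation and a distinguished atom -/

/-- A valuation `v` on a commutative monoid, at least `α` on nonunits, together with an atom `P` of
valuation `β` that divides every element of valuation at least `α + β`. -/
structure ValuedAtom {M : Type*} [CommMonoid M] (α β : ℕ) (v : M → ℕ) (P : M) : Prop where
  pos : 0 < α
  map_one : v 1 = 0
  map_mul : ∀ x y, v (x * y) = v x + v y
  le_of_ne_one : ∀ x, x ≠ 1 → α ≤ v x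
  irreducible : Irreducible P
  map_atom : v P = β
  dvd : ∀ x, α + β ≤ v x → P ∣ x

namespace ValuedAtom

variable {M : Type*} [CommMonoid M] {α β : ℕ} {v : M → ℕ} {P : M}

lemma card_mul_le (h : ValuedAtom α β v P) {z : Multiset M} (hz : ∀ u ∈ z, Irreducible u) :
    z.card * α ≤ v z.prod := by
  induction z using Multiset.induction_on with
  | empty => simp
  | cons u z ih =>
    have h1 := ih fun w hw => hz w (Multiset.mem_cons_of_mem hw)
    have h2 := h.le_of_ne_one u (hz u (Multiset.mem_cons_self u z)).ne_one
    rw [Multiset.card_cons, Multiset.prod_cons, h.map_mul, add_mul, one_mul]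
    omega

variable [Subsingleton Mˣ]

lemma irreducible_of_lt (h : ValuedAtom α β v P) {x : M} (hx : x ≠ 1) (hv : v x < 2 * α) :
    Irreducible x := by
  refine ⟨fun hu => hx (isUnit_iff_eq_one.1 hu), ?_⟩
  rintro y z rfl
  simp only [isUnit_iff_eq_one]
  by_contra! hyz
  have h1 := h.le_of_ne_one y hyz.1
  have h2 := h.le_of_ne_one z hyz.2
  rw [h.map_mul] at hv
  omega

lemma lt_of_irreducible (h : ValuedAtom α β v P) {x : M} (hx : Irreducible x) :
    v x < α + β := by
  by_contra! hle
  obtain ⟨y, rfl⟩ := h.dvd x hle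
  rcases hx.isUnit_or_isUnit rfl with hu | hu
  · exact h.irreducible.not_isUnit hu
  · rw [isUnit_iff_eq_one] at hu
    subst hu
    rw [mul_one, h.map_atom] at hle
    have := h.pos
    omega

lemma exists_factorization (h : ValuedAtom α β v P) (x : M) : ∃ z, z ∈ factorizations x := by
  induction hn : v x using Nat.strong_induction_on generalizing x with
  | _ n ih =>
    subst hn
    by_cases hx : x = 1
    · exact ⟨0, by simp, by simp [hx]⟩
    by_cases hi : Irreducible x
    · exact ⟨{x}, by simpa using hi, by simp⟩
    rw [irreducible_iff] at hi
    push Not at hi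
    obtain ⟨y, z, rfl, hy, hz⟩ := hi (fun hu => hx (isUnit_iff_eq_one.1 hu))
    rw [isUnit_iff_eq_one] at hy hz
    have h1 := h.le_of_ne_one y hy
    have h2 := h.le_of_ne_one z hz
    have h3 := h.map_mul y z
    have h4 := h.pos
    obtain ⟨f, hf⟩ := ih (v y) (by omega) y rfl
    obtain ⟨g, hg⟩ := ih (v z) (by omega) z rfl
    classical
    exact ⟨f + g, add_mem_factorizations hf hg⟩

variable [DecidableEq M]

/-- A multiset of atoms that is minimal with product of valuation at least `α + β` can be exchanged
for a factorization containing `P`, with at most `N` atoms on either side. -/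
lemma exists_exchange (h : ValuedAtom α β v P) {N : ℕ} (hN : α + β ≤ N * α)
    (h3 : α = 1 ∨ 3 ≤ N) {s : Multiset M} (hs : ∀ u ∈ s, Irreducible u)
    (hv : α + β ≤ v s.prod) (hmin : ∀ u ∈ s, v (s.erase u).prod < α + β) :
    s.card ≤ N ∧ ∃ f, (P ::ₘ f) ∈ factorizations s.prod ∧ (P ::ₘ f).card ≤ N := by
  have hα := h.pos
  have hs0 : s ≠ 0 := by
    rintro rfl
    rw [Multiset.prod_zero, h.map_one] at hv
    omega
  obtain ⟨A, hA⟩ := Multiset.exists_mem_of_ne_zero hs0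
  have herase := hmin A hA
  have hAlt := h.lt_of_irreducible (hs A hA)
  have hcard := h.card_mul_le (z := s.erase A) fun u hu => hs u (Multiset.mem_of_mem_erase hu)
  have hprod : v s.prod = v A + v (s.erase A).prod := by
    rw [← h.map_mul, Multiset.prod_erase hA]
  obtain ⟨t, ht⟩ := h.dvd _ hv
  have hvt : v s.prod = β + v t := by rw [ht, h.map_mul, h.map_atom]
  constructor
  · have := Multiset.card_erase_add_one hA
    have := lt_of_mul_lt_mul_right (hcard.trans_lt (herase.trans_le hN)) hα.le
    omega
  rw [ht]
  by_cases hlt : v t < α + β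
  · obtain ⟨f, hf⟩ := h.exists_factorization t
    refine ⟨f, cons_mem_factorizations h.irreducible hf, ?_⟩
    have hfc := h.card_mul_le hf.1
    rw [hf.2] at hfc
    have := lt_of_mul_lt_mul_right (hfc.trans_lt (hlt.trans_le hN)) hα.le
    rw [Multiset.card_cons]
    omega
  · -- The remaining cofactor has valuation at most `2 * α - 2`, hence at most one atom.
    obtain ⟨t', ht'⟩ := h.dvd t (not_lt.1 hlt)
    obtain ⟨f, hf⟩ := h.exists_factorization t'
    have hvt' : v t = β + v t' := by rw [ht', h.map_mul, h.map_atom]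
    refine ⟨P ::ₘ f, cons_mem_factorizations h.irreducible
      (ht' ▸ cons_mem_factorizations h.irreducible hf), ?_⟩
    have hfc := h.card_mul_le hf.1
    rw [hf.2] at hfc
    have hlt2 : f.card < 2 :=
      lt_of_mul_lt_mul_right (hfc.trans_lt (by omega : v t' < 2 * α)) hα.le
    rw [Multiset.card_cons, Multiset.card_cons]
    omega

variable [IsLeftCancelMul M]

/-- A single step of length at most `N` introduces `P` into a factorization. -/
lemma exists_step_cons (h : ValuedAtom α β v P) {N : ℕ} (hN : α + β ≤ N * α)
    (h3 : α = 1 ∨ 3 ≤ N) {y : M} (hv : α + β ≤ v (P * y)) {z : Multiset M}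
    (hz : z ∈ factorizations (P * y)) :
    ∃ f ∈ factorizations y, ChainStep (P * y) N z (P ::ₘ f) := by
  obtain ⟨s, ⟨hsz, hsv⟩, hmin⟩ := WellFounded.has_min
    (InvImage.wf Multiset.card (wellFounded_lt (α := ℕ)))
    {s : Multiset M | s ≤ z ∧ α + β ≤ v s.prod} ⟨z, le_rfl, by rwa [hz.2]⟩
  have hs : ∀ u ∈ s, Irreducible u := fun u hu => hz.1 u (Multiset.mem_of_le hsz hu)
  obtain ⟨hc, f, hf, hfc⟩ := h.exists_exchange hN h3 hs hsv (by
    intro u hu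
    by_contra! hle
    exact hmin (s.erase u) ⟨(Multiset.erase_le u s).trans hsz, hle⟩
      (Multiset.card_erase_lt_of_mem hu))
  obtain ⟨w, rfl⟩ := Multiset.le_iff_exists_add.1 hsz
  have hw : ∀ u ∈ w, Irreducible u := fun u hu => hz.1 u (Multiset.mem_add.2 (Or.inr hu))
  have hmem : P ::ₘ (f + w) ∈ factorizations (P * y) := by
    have h1 := add_mem_factorizations hf (show w ∈ factorizations w.prod from ⟨hw, rfl⟩)
    rw [← Multiset.prod_add, hz.2, Multiset.cons_add] at h1
    exact h1
  refine ⟨f + w, ⟨fun u hu => hmem.1 u (Multiset.mem_cons_of_mem hu),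
    mul_left_cancel (a := P) ?_⟩, hz, hmem, ?_⟩
  · rw [← Multiset.prod_cons]
    exact hmem.2
  · rw [← Multiset.cons_add, add_comm s, add_comm _ w, factorizationDist_add_left]
    exact factorizationDist_le hc hfc

lemma catenaryDegree_le (h : ValuedAtom α β v P) {N : ℕ} (hN : α + β ≤ N * α)
    (h3 : α = 1 ∨ 3 ≤ N) : catenaryDegree M ≤ N := by
  have hα := h.pos
  refine ACM.catenaryDegree_le (Nat.pos_of_ne_zero ?_) fun x z hz w hw =>
    hasChain_of_reflTransGen hw ?_
  · rintro rfl
    omega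
  induction hn : v x using Nat.strong_induction_on generalizing x z w with
  | _ n ih =>
    subst hn
    by_cases hlt : v x < α + β
    · have key : ∀ f ∈ factorizations x, f.card ≤ N := fun f hf => by
        have := h.card_mul_le hf.1
        rw [hf.2] at this
        exact (lt_of_mul_lt_mul_right (this.trans_lt (hlt.trans_le hN)) hα.le).le
      exact .single ⟨hz, hw, factorizationDist_le (key z hz) (key w hw)⟩
    · have hle := not_lt.1 hlt
      obtain ⟨y, rfl⟩ := h.dvd x hle
      obtain ⟨f, hf, hzf⟩ := h.exists_step_cons hN h3 hle hz
      obtain ⟨g, hg, hwg⟩ := h.exists_step_cons hN h3 hle hw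
      have hP := h.le_of_ne_one P h.irreducible.ne_one
      have hfg := ih (v y) (by rw [h.map_mul]; omega) y f hf g hg rfl
      exact .head hzf (.tail (hfg.lift (P ::ₘ ·) fun _ _ hs => hs.cons h.irreducible) hwg.symm)

end ValuedAtom

/-! ### Short steps between factorizations -/

section Short

variable {M : Type*} [CommMonoid M] [Subsingleton Mˣ] [DecidableEq M] [IsLeftCancelMul M]

lemma prod_sub_eq_prod_sub {x : M} {z w : Multiset M} (hz : z ∈ factorizations x)
    (hw : w ∈ factorizations x) : (z - w).prod = (w - z).prod := by
  have hzi : z - w + z ∩ w = z := Multiset.sub_add_inter z w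
  have hwi : w - z + z ∩ w = w := by rw [Multiset.inter_comm, Multiset.sub_add_inter]
  apply mul_left_cancel (a := (z ∩ w).prod)
  rw [← Multiset.prod_add, ← Multiset.prod_add, add_comm, hzi, add_comm, hwi, hz.2, hw.2]

/-- Steps of length at most `2` preserve the number of atoms, because an atom is not a product of
two atoms. -/
lemma ChainStep.card_eq {x : M} {z w : Multiset M} (h : ChainStep x 2 z w) :
    z.card = w.card := by
  obtain ⟨hz, hw, hd⟩ := h
  have key : ∀ s t : Multiset M, (∀ u ∈ s, Irreducible u) → (∀ u ∈ t, Irreducible u) →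
      s.prod = t.prod → t.card ≤ 2 → ¬ s.card < t.card := by
    intro s t hs ht hst h2 hlt
    obtain h0 | h1 : s.card = 0 ∨ s.card = 1 := by omega
    · rw [Multiset.card_eq_zero.1 h0, Multiset.prod_zero] at hst
      obtain ⟨u, hu⟩ := Multiset.card_pos_iff_exists_mem.1 (by omega : 0 < t.card)
      exact (ht u hu).not_isUnit (isUnit_of_dvd_one (hst ▸ Multiset.dvd_prod hu))
    · obtain ⟨A, rfl⟩ := Multiset.card_eq_one.1 h1
      obtain ⟨B, C, rfl⟩ := Multiset.card_eq_two.1 (by omega : t.card = 2)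
      simp only [Multiset.prod_singleton, Multiset.insert_eq_cons, Multiset.prod_cons] at hst
      rcases (hs A (by simp)).isUnit_or_isUnit hst with hu | hu
      · exact (ht B (by simp)).not_isUnit hu
      · exact (ht C (by simp)).not_isUnit hu
  have hprod := prod_sub_eq_prod_sub hz hw
  have h1 : ∀ u ∈ z - w, Irreducible u := fun u hu => hz.1 u (Multiset.mem_of_le tsub_le_self hu)
  have h2 : ∀ u ∈ w - z, Irreducible u := fun u hu => hw.1 u (Multiset.mem_of_le tsub_le_self hu)
  have hle := key _ _ h1 h2 hprod ((le_max_right _ _).trans hd)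
  have hge := key _ _ h2 h1 hprod.symm ((le_max_left _ _).trans hd)
  have hzc := congrArg Multiset.card (Multiset.sub_add_inter z w)
  have hwc := congrArg Multiset.card (Multiset.sub_add_inter w z)
  rw [Multiset.inter_comm] at hwc
  rw [Multiset.card_add] at hzc hwc
  omega

/-- No step of length at most `1` is proper: a single atom cannot be exchanged for another one. -/
lemma ChainStep.eq {x : M} {z w : Multiset M} (h : ChainStep x 1 z w) : z = w := by
  have hcard := ChainStep.card_eq ⟨h.1, h.2.1, h.2.2.trans one_le_two⟩
  have hprod := prod_sub_eq_prod_sub h.1 h.2.1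
  have h1 : (z - w).card ≤ 1 := (le_max_left _ _).trans h.2.2
  have h2 : (w - z).card ≤ 1 := (le_max_right _ _).trans h.2.2
  have hzi := Multiset.sub_add_inter z w
  have hwi := Multiset.sub_add_inter w z
  rw [Multiset.inter_comm] at hwi
  have hzc := congrArg Multiset.card hzi
  have hwc := congrArg Multiset.card hwi
  rw [Multiset.card_add] at hzc hwc
  have hsub : z - w = w - z := by
    obtain h0 | h0 : (z - w).card = 0 ∨ (z - w).card = 1 := by omega
    · rw [Multiset.card_eq_zero.1 h0, Multiset.card_eq_zero.1 (by omega : (w - z).card = 0)]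
    · obtain ⟨A, hA⟩ := Multiset.card_eq_one.1 h0
      obtain ⟨B, hB⟩ := Multiset.card_eq_one.1 (by omega : (w - z).card = 1)
      rw [hA, hB, Multiset.prod_singleton, Multiset.prod_singleton] at hprod
      rw [hA, hB, hprod]
  exact hzi.symm.trans (hsub ▸ hwi)

end Short

/-! ### Local singular arithmetical congruence monoids -/

/-- The submonoid `S` of `ℕ` consists of `1` and the positive integers that are divisible by
`p ^ α` and congruent to `1` modulo `b`, where `p` is a prime not dividing `b`; and `p ^ β` is the
least power of `p` other than `1` in `S`. This is the shape of a local singular arithmetical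
congruence monoid. -/
structure IsLocalACM (p b α β : ℕ) (S : Submonoid ℕ) : Prop where
  prime : p.Prime
  pos : 0 < α
  coprime : p.Coprime b
  mem_iff : ∀ x, x ∈ S ↔ x = 1 ∨ 0 < x ∧ p ^ α ∣ x ∧ x ≡ 1 [MOD b]
  isLeast : IsLeast {k : ℕ | 0 < k ∧ p ^ k ∈ S} β

lemma factorization_pow_mul {p u : ℕ} (hp : p.Prime) (hu : ¬ p ∣ u) (k : ℕ) :
    (p ^ k * u).factorization p = k := by
  have hu0 : u ≠ 0 := by rintro rfl; simp at hu
  rw [Nat.factorization_mul (pow_ne_zero _ hp.ne_zero) hu0, Finsupp.add_apply,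
    hp.factorization_pow, Finsupp.single_eq_same, Nat.factorization_eq_zero_of_not_dvd hu,
    add_zero]

/-- Membership in `acm (a * p ^ α) (b * p ^ α)`, using that `a * p ^ α` is `1` modulo `b`. -/
lemma isLocalACM_acm {p a b α β : ℕ} (hp : p.Prime) (hα : 0 < α)
    (ha : 0 < a) (hab : a ≤ b) (hcop : Nat.Coprime a b)
    (hM : (a * p ^ α) ^ 2 ≡ a * p ^ α [MOD b * p ^ α])
    (hβ : IsLeast {k : ℕ | 0 < k ∧ p ^ k ∈ acm (a * p ^ α) (b * p ^ α) hM} β) :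
    IsLocalACM p b α β (acm (a * p ^ α) (b * p ^ α) hM) := by
  have hpα : 0 < p ^ α := pow_pos hp.pos α
  have hone : p ^ α * a ≡ 1 [MOD b] := by
    have h1 : a * (p ^ α * a) * p ^ α ≡ a * 1 * p ^ α [MOD b * p ^ α] := by
      convert hM using 1 <;> ring
    exact Nat.ModEq.cancel_left_of_coprime hcop.symm
      (Nat.ModEq.mul_right_cancel' hpα.ne' h1)
  have hcopα : Nat.Coprime (p ^ α) b := by
    have h1 : Nat.Coprime (p ^ α * a) b := by
      rw [Nat.Coprime, hone.gcd_eq, Nat.gcd_one_left]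
    exact h1.coprime_mul_right
  refine ⟨hp, hα, (Nat.coprime_pow_left_iff hα _ _).1 hcopα, fun x => or_congr_right ?_, hβ⟩
  constructor
  · rintro ⟨k, rfl⟩
    refine ⟨by positivity, ⟨a + k * b, by ring⟩, ?_⟩
    calc a * p ^ α + k * (b * p ^ α) = p ^ α * a + b * (k * p ^ α) := by ring
      _ ≡ p ^ α * a + 0 [MOD b] := Nat.ModEq.add_left _ (Nat.modEq_zero_iff_dvd.2 ⟨_, rfl⟩)
      _ ≡ 1 [MOD b] := hone
  · rintro ⟨hx, ⟨y, rfl⟩, hy⟩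
    have hya : a ≡ y [MOD b] :=
      (Nat.ModEq.cancel_left_of_coprime hcopα.symm (hy.trans hone.symm)).symm
    have hy0 : 0 < y := Nat.pos_of_mul_pos_left hx
    -- `a` is the least positive residue in its class, so `y` cannot lie below it.
    have hle : a ≤ y := by
      by_contra! hlt
      have := Nat.le_of_dvd (by omega) ((Nat.modEq_iff_dvd' hlt.le).1 hya.symm)
      omega
    obtain ⟨k, hk⟩ := (Nat.modEq_iff_dvd' hle).1 hya
    refine ⟨k, ?_⟩
    rw [show y = a + b * k by omega]
    ring

namespace IsLocalACM

variable {p b α β : ℕ} {S : Submonoid ℕ}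

lemma mem (h : IsLocalACM p b α β S) {x : ℕ} (hx : 0 < x) (hpx : p ^ α ∣ x)
    (hb : x ≡ 1 [MOD b]) : x ∈ S :=
  (h.mem_iff x).2 (Or.inr ⟨hx, hpx, hb⟩)

lemma pos_of_mem (h : IsLocalACM p b α β S) {x : ℕ} (hx : x ∈ S) : 0 < x := by
  rcases (h.mem_iff x).1 hx with rfl | hx
  exacts [one_pos, hx.1]

lemma modEq_one (h : IsLocalACM p b α β S) {x : ℕ} (hx : x ∈ S) : x ≡ 1 [MOD b] := by
  rcases (h.mem_iff x).1 hx with rfl | hx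
  exacts [rfl, hx.2.2]

lemma pow_mem (h : IsLocalACM p b α β S) : p ^ β ∈ S := h.isLeast.1.2

lemma modulus_pos (h : IsLocalACM p b α β S) : 0 < b := by
  refine Nat.pos_of_ne_zero fun hb => h.prime.ne_one ?_
  simpa [hb] using h.coprime

lemma isLeftCancelMul (h : IsLocalACM p b α β S) : IsLeftCancelMul S :=
  ⟨fun x _ _ hyz => Subtype.ext
    (Nat.eq_of_mul_eq_mul_left (h.pos_of_mem x.2) (congrArg Subtype.val hyz))⟩

lemma le_factorization (h : IsLocalACM p b α β S) {x : ℕ} (hx : x ∈ S) (hx1 : x ≠ 1) :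
    α ≤ x.factorization p := by
  rcases (h.mem_iff x).1 hx with rfl | hx
  · exact absurd rfl hx1
  · exact (h.prime.pow_dvd_iff_le_factorization hx.1.ne').1 hx.2.1

lemma le_of_pow_modEq_one (h : IsLocalACM p b α β S) {k : ℕ} (hk : α ≤ k)
    (hb : p ^ k ≡ 1 [MOD b]) : β ≤ k :=
  h.isLeast.2 ⟨h.pos.trans_le hk, h.mem (pow_pos h.prime.pos k) (pow_dvd_pow p hk) hb⟩

lemma valuedAtom (h : IsLocalACM p b α β S) [Subsingleton Sˣ] :
    ValuedAtom α β (fun x : S => (x : ℕ).factorization p) ⟨p ^ β, h.pow_mem⟩ where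
  pos := h.pos
  map_one := by simp
  map_mul x y := by
    simp [Nat.factorization_mul (h.pos_of_mem x.2).ne' (h.pos_of_mem y.2).ne']
  le_of_ne_one x hx := h.le_factorization x.2 fun hx1 => hx (Subtype.ext hx1)
  irreducible := by
    refine ⟨fun hu => ?_, ?_⟩
    · have h1 := congrArg Subtype.val (isUnit_iff_eq_one.1 hu)
      exact (Nat.one_lt_pow h.isLeast.1.1.ne' h.prime.one_lt).ne' h1
    · intro x y hxy
      have hxy' : p ^ β = x * y := congrArg Subtype.val hxy
      obtain ⟨i, hi, hx⟩ := (Nat.dvd_prime_pow h.prime).1 (Dvd.intro _ hxy'.symm)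
      obtain ⟨j, hj, hy⟩ := (Nat.dvd_prime_pow h.prime).1 (Dvd.intro_left _ hxy'.symm)
      rw [hx, hy, ← pow_add] at hxy'
      have hij := Nat.pow_right_injective h.prime.two_le hxy'
      simp only [isUnit_iff_eq_one]
      by_contra! hne
      have hi0 : i ≠ 0 := by
        rintro rfl
        exact hne.1 (Subtype.ext (by simpa using hx))
      have hj0 : j ≠ 0 := by
        rintro rfl
        exact hne.2 (Subtype.ext (by simpa using hy))
      have := h.isLeast.2 ⟨Nat.pos_of_ne_zero hi0, hx ▸ x.2⟩
      omega
  map_atom := by simp [h.prime.factorization_pow]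
  dvd x hx := by
    have hx0 := h.pos_of_mem x.2
    obtain ⟨y, hy⟩ := (h.prime.pow_dvd_iff_le_factorization hx0.ne').2 hx
    have hxy : (x : ℕ) = p ^ β * (p ^ α * y) := by rw [hy, pow_add]; ring
    have hmem : p ^ α * y ∈ S := by
      refine h.mem (Nat.pos_of_mul_pos_left (hxy ▸ hx0)) (Dvd.intro _ rfl) ?_
      calc p ^ α * y = 1 * (p ^ α * y) := (one_mul _).symm
        _ ≡ p ^ β * (p ^ α * y) [MOD b] := (h.modEq_one h.pow_mem).symm.mul_right _
        _ ≡ 1 [MOD b] := hxy ▸ h.modEq_one x.2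
    exact ⟨⟨_, hmem⟩, Subtype.ext hxy⟩

lemma irreducible_pow_mul (h : IsLocalACM p b α β S) [Subsingleton Sˣ] {k u : ℕ}
    (hk : α ≤ k) (hk2 : k < 2 * α) (hu : ¬ p ∣ u) (hmem : p ^ k * u ∈ S) :
    Irreducible (⟨p ^ k * u, hmem⟩ : S) := by
  have hval := factorization_pow_mul h.prime hu k
  refine h.valuedAtom.irreducible_of_lt (fun h1 => ?_) (by simpa only [hval] using hk2)
  have h2 : p ^ k * u = 1 := congrArg Subtype.val h1
  rw [h2, Nat.factorization_one, Finsupp.zero_apply] at hval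
  have := h.pos
  omega

/-- With `u = 1 + p * b`, which is `1` modulo both `p` and `b`, the element `(p * u) ^ 2` has the
second factorization `p * (p * u ^ 2)`. -/
lemma two_le_catenaryDegree (h : IsLocalACM p b 1 1 S) [Subsingleton Sˣ] :
    2 ≤ catenaryDegree S := by
  have := h.isLeftCancelMul
  have hb := h.modulus_pos
  have hp := h.prime.pos
  have hp1 : p ≡ 1 [MOD b] := by simpa using h.modEq_one h.pow_mem
  have hu1 : 1 + p * b ≡ 1 [MOD b] := by simp [Nat.ModEq]
  have hpu : ¬ p ∣ 1 + p * b := by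
    rw [Nat.dvd_add_left (Dvd.intro _ rfl)]
    exact h.prime.not_dvd_one
  have hA : p ^ 1 * (1 + p * b) ∈ S := by
    refine h.mem (by positivity) (Dvd.intro _ rfl) ?_
    simpa using hp1.mul hu1
  have hB : p ^ 1 * (1 + p * b) ^ 2 ∈ S := by
    refine h.mem (by positivity) (Dvd.intro _ rfl) ?_
    simpa using hp1.mul (hu1.pow 2)
  have hAi := h.irreducible_pow_mul le_rfl (by norm_num) hpu hA
  have hBi := h.irreducible_pow_mul le_rfl (by norm_num)
    (fun hd => hpu (h.prime.dvd_of_dvd_pow hd)) hB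
  have hPi := h.valuedAtom.irreducible
  refine succ_le_catenaryDegree (N := 1) (z := {⟨_, hA⟩, ⟨_, hA⟩})
    (w := {⟨_, h.pow_mem⟩, ⟨_, hB⟩}) (x := ⟨_, hA⟩ * ⟨_, hA⟩) ⟨?_, by simp⟩ ⟨?_, ?_⟩
    (fun z => z = {⟨_, hA⟩, ⟨_, hA⟩}) rfl ?_ (fun u v huv hu => huv.eq ▸ hu)
  · simpa using hAi
  · rintro u hu
    rcases Multiset.mem_cons.1 hu with rfl | hu
    · exact hPi
    · exact Multiset.mem_singleton.1 hu ▸ hBi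
  · refine Subtype.ext ?_
    simp
    ring
  · intro heq
    have hmem : (⟨_, h.pow_mem⟩ : S) ∈ ({⟨_, hA⟩, ⟨_, hA⟩} : Multiset S) := heq ▸ by simp
    have h1 : p ^ 1 = p ^ 1 * (1 + p * b) := by simpa using hmem
    have : 0 < p * b := by positivity
    nlinarith

/-- With `u = p + b`, which is prime to `p` and congruent to `p` modulo `b`, the element
`(p ^ (2 * α - 1) * u) ^ 2` has the longer factorization
`p ^ α * p ^ α * (p ^ (2 * α - 2) * u ^ 2)`. The last factor has valuation at least `α` because `α > 1`. -/
lemma three_le_catenaryDegree (h : IsLocalACM p b α α S) [Subsingleton Sˣ] (hα : 1 < α) :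
    3 ≤ catenaryDegree S := by
  have := h.isLeftCancelMul
  have hb := h.modulus_pos
  have hp := h.prime.pos
  obtain ⟨k, rfl⟩ := Nat.exists_eq_add_of_le' hα
  have hα1 := h.modEq_one h.pow_mem
  have hu1 : p + b ≡ p [MOD b] := by simp [Nat.ModEq]
  have hpu : ¬ p ∣ p + b := by
    rw [Nat.dvd_add_right (dvd_refl p)]
    exact (h.prime.coprime_iff_not_dvd).1 h.coprime
  have hA : p ^ (2 * k + 3) * (p + b) ∈ S := by
    refine h.mem (by positivity) ((pow_dvd_pow p (by omega)).mul_right _) ?_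
    calc p ^ (2 * k + 3) * (p + b) ≡ p ^ (2 * k + 3) * p [MOD b] := hu1.mul_left _
      _ = (p ^ (k + 2)) ^ 2 := by ring
      _ ≡ 1 ^ 2 [MOD b] := hα1.pow 2
  have hB : p ^ (2 * k + 2) * (p + b) ^ 2 ∈ S := by
    refine h.mem (by positivity) ((pow_dvd_pow p (by omega)).mul_right _) ?_
    calc p ^ (2 * k + 2) * (p + b) ^ 2 ≡ p ^ (2 * k + 2) * p ^ 2 [MOD b] := (hu1.pow 2).mul_left _
      _ = (p ^ (k + 2)) ^ 2 := by ring
      _ ≡ 1 ^ 2 [MOD b] := hα1.pow 2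
  have hAi := h.irreducible_pow_mul (by omega) (by omega) hpu hA
  have hBi := h.irreducible_pow_mul (by omega) (by omega)
    (fun hd => hpu (h.prime.dvd_of_dvd_pow hd)) hB
  have hPi := h.valuedAtom.irreducible
  refine succ_le_catenaryDegree (N := 2) (z := {⟨_, hA⟩, ⟨_, hA⟩})
    (w := {⟨_, h.pow_mem⟩, ⟨_, h.pow_mem⟩, ⟨_, hB⟩}) (x := ⟨_, hA⟩ * ⟨_, hA⟩) ⟨?_, by simp⟩
    ⟨?_, ?_⟩ (fun z => z.card = 2) rfl (by simp) (fun u v huv hu => huv.card_eq ▸ hu)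
  · simpa using hAi
  · simpa using ⟨hPi, hBi⟩
  · refine Subtype.ext ?_
    simp
    ring

/-! ### Powers of an atom of minimal valuation -/

/-- For an element `p ^ k * q ^ j` of the monoid, either `k ≤ α * j` or `k ≥ β`: otherwise
`p ^ (k - α * j)` is `1` modulo `b`, and a power of it would lie in the monoid below `p ^ β`. -/
lemma le_or_le_of_pow_mul_pow_mem (h : IsLocalACM p b α β S) {q k j : ℕ}
    (hq : p ^ α * q ≡ 1 [MOD b]) (hk : α ≤ k) (hmem : p ^ k * q ^ j ∈ S) :
    k ≤ α * j ∨ β ≤ k := by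
  refine or_iff_not_imp_left.2 fun hlt => ?_
  rw [not_le] at hlt
  obtain ⟨d, rfl⟩ := Nat.exists_eq_add_of_lt hlt
  have hd : p ^ (d + 1) ≡ 1 [MOD b] := by
    refine Nat.ModEq.cancel_left_of_coprime (c := p ^ (α * j)) (h.coprime.symm.pow_right _) ?_
    calc p ^ (α * j) * p ^ (d + 1) = p ^ (α * j + d + 1) * 1 ^ j := by ring
      _ ≡ p ^ (α * j + d + 1) * (p ^ α * q) ^ j [MOD b] := (hq.symm.pow j).mul_left _
      _ = p ^ (α * j) * (p ^ (α * j + d + 1) * q ^ j) := by rw [mul_pow, ← pow_mul]; ring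
      _ ≡ p ^ (α * j) * 1 [MOD b] := (h.modEq_one hmem).mul_left _
  rcases Nat.eq_zero_or_pos j with rfl | hj
  · exact h.le_of_pow_modEq_one hk (by simpa using hd)
  · -- The least multiple of `d + 1` that is at least `α` is at most `α + d`.
    have h1 : p ^ ((d + 1) * ((α + d) / (d + 1))) ≡ 1 [MOD b] := by
      rw [pow_mul]
      simpa using hd.pow ((α + d) / (d + 1))
    have h2 := Nat.mul_div_le (α + d) (d + 1)
    have h3 := Nat.lt_mul_div_succ (α + d) (Nat.succ_pos d)
    have h4 : α ≤ α * j := Nat.le_mul_of_pos_right α hj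
    have := h.le_of_pow_modEq_one (by rw [Nat.succ_eq_add_one, mul_add] at h3; omega) h1
    omega

/-- If `r * α < α + β`, the `r`-th power of the atom `p ^ α * q` has no atomic divisor other than
this atom. -/
lemma eq_of_irreducible_of_mul_eq_pow (h : IsLocalACM p b α β S) [Subsingleton Sˣ] {q r : ℕ}
    (hq : q.Prime) (hpq : p ≠ q) (hmem : p ^ α * q ∈ S) (hr : 2 ≤ r) (hrβ : r * α < α + β)
    {e f : S} (he : Irreducible e) (hef : e * f = ⟨p ^ α * q, hmem⟩ ^ r) :
    e = ⟨p ^ α * q, hmem⟩ := by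
  have hval : (e : ℕ) * f = p ^ (α * r) * q ^ r := by
    rw [pow_mul, ← mul_pow]
    exact congrArg Subtype.val hef
  have key : ∀ x : ℕ, x ∣ p ^ (α * r) * q ^ r → ∃ k j, x = p ^ k * q ^ j := by
    intro x hx
    obtain ⟨y, z, hy, hz, rfl⟩ := (Nat.dvd_mul).1 hx
    obtain ⟨k, -, rfl⟩ := (Nat.dvd_prime_pow h.prime).1 hy
    obtain ⟨j, -, rfl⟩ := (Nat.dvd_prime_pow hq).1 hz
    exact ⟨k, j, rfl⟩
  obtain ⟨k, j, hek⟩ := key e (Dvd.intro _ hval)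
  obtain ⟨k', j', hfk⟩ := key f (Dvd.intro_left _ hval)
  have hpq' : ∀ n, ¬ p ∣ q ^ n := fun n hd =>
    hpq ((Nat.prime_dvd_prime_iff_eq h.prime hq).1 (h.prime.dvd_of_dvd_pow hd))
  have hqp' : ∀ n, ¬ q ∣ p ^ n := fun n hd =>
    hpq ((Nat.prime_dvd_prime_iff_eq hq h.prime).1 (hq.dvd_of_dvd_pow hd)).symm
  have hmul : p ^ (k + k') * q ^ (j + j') = p ^ (α * r) * q ^ r := by
    rw [← hval, hek, hfk]
    ring
  have hkk : k + k' = α * r := by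
    rw [← factorization_pow_mul h.prime (hpq' (j + j')) (k + k'), hmul,
      factorization_pow_mul h.prime (hpq' r)]
  have hjj : j + j' = r := by
    rw [← factorization_pow_mul hq (hqp' (k + k')) (j + j'), mul_comm, hmul, mul_comm,
      factorization_pow_mul hq (hqp' (α * r))]
  have hek' : (e : ℕ).factorization p = k := by rw [hek, factorization_pow_mul h.prime (hpq' j)]
  have hfk' : (f : ℕ).factorization p = k' := by rw [hfk, factorization_pow_mul h.prime (hpq' j')]
  have hkα : α ≤ k := hek' ▸ h.valuedAtom.le_of_ne_one e he.ne_one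
  have hpow : ∀ n, n ≠ 1 → e ≠ ⟨p ^ α * q, hmem⟩ ^ n := by
    rintro n hn rfl
    exact not_irreducible_pow hn he
  have hf1 : f ≠ 1 := by
    rintro rfl
    exact hpow r (by omega) (by rw [← hef, mul_one])
  have hkα' : α ≤ k' := hfk' ▸ h.valuedAtom.le_of_ne_one f hf1
  have hq1 := h.modEq_one hmem
  have hαr : α * r = r * α := mul_comm _ _
  have h1 := (h.le_or_le_of_pow_mul_pow_mem hq1 hkα (hek ▸ e.2)).resolve_right (by omega)
  have h2 := (h.le_or_le_of_pow_mul_pow_mem hq1 hkα' (hfk ▸ f.2)).resolve_right (by omega)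
  have hk : k = α * j := by
    rw [← hjj, mul_add] at hkk
    omega
  have hej : e = ⟨p ^ α * q, hmem⟩ ^ j := by
    refine Subtype.ext ?_
    rw [hek, hk, pow_mul, ← mul_pow]
    rfl
  by_contra hne
  refine hpow j ?_ hej
  rintro rfl
  exact hne (by rw [hej, pow_one])

/-- The lower bound for `α < β`, in which case `r = ⌈β / α⌉` satisfies the hypotheses: no step of
length at most `r` leaves the factorization of `g ^ (r + 1)` into copies of the atom
`g = p ^ α * q`. -/
lemma add_one_le_catenaryDegree (h : IsLocalACM p b α β S) [Subsingleton Sˣ] {a r : ℕ}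
    (hab : Nat.Coprime a b) (ha : p ^ α * a ≡ 1 [MOD b]) (hr : 2 ≤ r) (hβr : β ≤ r * α)
    (hrβ : r * α < α + β) : ((r + 1 : ℕ) : ℕ∞) ≤ catenaryDegree S := by
  have := h.isLeftCancelMul
  obtain ⟨q, hpq, hq, hqa⟩ := Nat.forall_exists_prime_gt_and_modEq p h.modulus_pos.ne' hab
  have hpdvd : ¬ p ∣ q := fun hd =>
    hpq.ne ((Nat.prime_dvd_prime_iff_eq h.prime hq).1 hd)
  have hmem : p ^ α * q ∈ S :=
    h.mem (mul_pos (pow_pos h.prime.pos α) hq.pos) (Dvd.intro _ rfl) ((hqa.mul_left _).trans ha)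
  have hgi := h.irreducible_pow_mul le_rfl (by have := h.pos; omega) hpdvd hmem
  set g : S := ⟨p ^ α * q, hmem⟩
  have hgv : ∀ n, ((g ^ n : S) : ℕ).factorization p = n * α := by
    intro n
    rw [SubmonoidClass.coe_pow, Nat.factorization_pow, Finsupp.smul_apply,
      factorization_pow_mul h.prime hpdvd, smul_eq_mul]
  obtain ⟨y, hy⟩ := h.valuedAtom.dvd (g ^ (r + 1)) (by simp only [hgv, add_mul]; omega)
  obtain ⟨f, hf⟩ := h.valuedAtom.exists_factorization y
  have hw := cons_mem_factorizations h.valuedAtom.irreducible hf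
  rw [← hy] at hw
  refine succ_le_catenaryDegree (z := Multiset.replicate (r + 1) g)
    ⟨fun u hu => Multiset.eq_of_mem_replicate hu ▸ hgi, Multiset.prod_replicate _ _⟩ hw
    (fun z => z = Multiset.replicate (r + 1) g) rfl ?_ ?_
  · intro heq
    have hPg : ⟨p ^ β, h.pow_mem⟩ = g :=
      Multiset.eq_of_mem_replicate (heq ▸ Multiset.mem_cons_self _ f)
    have hqd : q ∣ p ^ β := by
      rw [show p ^ β = p ^ α * q from congrArg Subtype.val hPg]
      exact Dvd.intro_left _ rfl
    exact hpq.ne ((Nat.prime_dvd_prime_iff_eq hq h.prime).1 (hq.dvd_of_dvd_pow hqd)).symm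
  · rintro _ w ⟨-, hw, hd⟩ rfl
    -- As the step is short, the two factorizations share a copy of `g`.
    have hgw : g ∈ w := by
      by_contra hgw
      have h1 : Multiset.replicate (r + 1) g - w = Multiset.replicate (r + 1) g := by
        ext u
        rcases eq_or_ne u g with rfl | hu
        · simp [Multiset.count_eq_zero_of_notMem hgw]
        · rw [Multiset.count_sub, Multiset.count_replicate, if_neg hu.symm, zero_tsub]
      have h2 := (le_max_left _ _).trans hd
      rw [h1, Multiset.card_replicate] at h2
      omega
    have hwg : (w.erase g).prod = g ^ r := by
      apply mul_left_cancel (a := g)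
      rw [Multiset.prod_erase hgw, hw.2, pow_succ']
    have hall : ∀ u ∈ w, u = g := by
      intro u hu
      by_contra hne
      have hu' : u ∈ w.erase g := (Multiset.mem_erase_of_ne hne).2 hu
      exact hne (h.eq_of_irreducible_of_mul_eq_pow hq hpq.ne hmem hr hrβ (hw.1 u hu)
        ((Multiset.prod_erase hu').trans hwg))
    have hwr := Multiset.eq_replicate_card.2 hall
    have hcard : w.card = r + 1 := by
      have h1 : g ^ w.card = g ^ (r + 1) := by
        rw [← Multiset.prod_replicate, ← hwr, hw.2]
      have h2 : w.card * α = (r + 1) * α := by rw [← hgv, ← hgv, h1]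
      exact Nat.eq_of_mul_eq_mul_right h.pos h2
    rw [hwr, hcard]

end IsLocalACM

end ACM

theorem theorem5p1 (p a b α β : ℕ) (hp : p.Prime) (hα : 0 < α)
    (ha : 0 < a) (hab : a ≤ b) (hcop : Nat.Coprime a b)
    (hM : (a * p ^ α) ^ 2 ≡ a * p ^ α [MOD b * p ^ α])
    (hβ : IsLeast {k : ℕ | 0 < k ∧ p ^ k ∈ ACM.acm (a * p ^ α) (b * p ^ α) hM} β) :
    (α = 1 ∧ β = 1 →
      ACM.catenaryDegree (ACM.acm (a * p ^ α) (b * p ^ α) hM) = 2) ∧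
    (α = β ∧ 1 < β →
      ACM.catenaryDegree (ACM.acm (a * p ^ α) (b * p ^ α) hM) = 3) ∧
    (α < β →
      ACM.catenaryDegree (ACM.acm (a * p ^ α) (b * p ^ α) hM) =
        ((1 + ⌈(β : ℚ) / (α : ℚ)⌉₊ : ℕ) : ℕ∞)) := by
  have h := ACM.isLocalACM_acm hp hα ha hab hcop hM hβ
  have := h.isLeftCancelMul
  refine ⟨?_, ?_, ?_⟩
  · rintro ⟨rfl, rfl⟩
    exact le_antisymm (h.valuedAtom.catenaryDegree_le (N := 2) le_rfl (Or.inl rfl))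
      h.two_le_catenaryDegree
  · rintro ⟨rfl, hα1⟩
    exact le_antisymm (h.valuedAtom.catenaryDegree_le (N := 3) (by omega) (Or.inr le_rfl))
      (h.three_le_catenaryDegree hα1)
  · intro hαβ
    have hα' : (0 : ℚ) < α := by exact_mod_cast hα
    set r := ⌈(β : ℚ) / (α : ℚ)⌉₊
    have hβr : β ≤ r * α := by
      have h1 := Nat.le_ceil ((β : ℚ) / α)
      rw [div_le_iff₀ hα'] at h1
      exact_mod_cast h1
    have hrβ : r * α < α + β := by
      have h1 := Nat.ceil_lt_add_one (show (0 : ℚ) ≤ (β : ℚ) / α by positivity)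
      rw [div_add_one hα'.ne', lt_div_iff₀ hα', add_comm] at h1
      exact_mod_cast h1
    have hr2 : 2 ≤ r := by
      by_contra! hlt
      have h1 : r * α ≤ 1 * α := Nat.mul_le_mul_right α (by omega)
      omega
    have ha1 : p ^ α * a ≡ 1 [MOD b] := by
      have h1 : a * p ^ α ∈ ACM.acm (a * p ^ α) (b * p ^ α) hM := Or.inr ⟨0, by simp⟩
      rw [mul_comm]
      exact h.modEq_one h1
    rw [add_comm 1 r]
    exact le_antisymm
      (h.valuedAtom.catenaryDegree_le (by rw [add_mul]; omega) (Or.inr (by omega)))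
      (h.add_one_le_catenaryDegree hcop ha1 hr2 hβr hrβ)
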